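/- An instance of the two-sided matching problem consists of $m$ workers $W$, $n$ firms $F$, a capacity $c_f\in\{0,1,2,\dots\}$ for every firm $f$, and values $v_{w,f}, v_{f,w}\in\{0,1,2,\dots\}$ for every worker $w$ and every firm $f$. A matching is a function $\mu: W\times F\to\{0,1\}$ with $\sum_{f\in F}\mu(w,f)\le 1$ for every $w\in W$ and $\sum_{w\in W}\mu(w,f)\le c_f$ for every $f\in F$. Under $\mu$, worker $w$ has utility $u_w(\mu)=\sum_{f\in F} v_{w,f}\,\mu(w,f)$ and firm $f$ has utility $u_f(\mu)=\sum_{w\in W} v_{f,w}\,\mu(w,f)$. The Nash welfare of $\mu$ is the geometric mean of the utilities of all agents, $\bigl(\prod_{i\in W\cup F} u_i(\mu)\bigr)^{1/(n+m)}$ (read as $1$ if $n+m=0$). **Proposition.** There is a polynomial-time algorithm that, given any two-sided matching instance, determines whether there exists a matching with nonzero Nash welfare. Here the instance is given as the list of the numbers $m$, $n$, $(c_f)$, $(v_{w,f})$, $(v_{f,w})$, an algorithm is a program for a random access machine with addition and subtraction (each at unit cost), and the running time is bounded by a polynomial in the total length of the binary expansions of the numbers in the list plus the number of entries of the list. -/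

import Mathlib

/-! ## Two-sided matching instances -/

/-- An instance of the two-sided matching problem with `m` workers, `n` firms, capacities `cap f`,
the value `workerVal w f` of worker `w` for firm `f`, and the value `firmVal f w` of firm `f` for
worker `w`. Values are natural numbers (possibly zero); firms value sets of workers additively. -/
structure MatchingInstance where
  m : ℕ
  n : ℕ
  cap : Fin n → ℕ
  workerVal : Fin m → Fin n → ℕ
  firmVal : Fin n → Fin m → ℕ

namespace MatchingInstance

/-- A (many-to-one) matching: a zero-one function on worker-firm pairs such that every worker is
matched with at most one firm and every firm `f` with at most `cap f` workers. -/
structure IsMatching (I : MatchingInstance) (μ : Fin I.m → Fin I.n → ℕ) : Prop where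
  zero_or_one : ∀ w f, μ w f = 0 ∨ μ w f = 1
  worker_le : ∀ w, ∑ f, μ w f ≤ 1
  firm_le : ∀ f, ∑ w, μ w f ≤ I.cap f

/-- The utility of worker `w` under `μ`. -/
def workerUtility (I : MatchingInstance) (μ : Fin I.m → Fin I.n → ℕ) (w : Fin I.m) : ℕ :=
  ∑ f, I.workerVal w f * μ w f

/-- The utility of firm `f` under `μ`. -/
def firmUtility (I : MatchingInstance) (μ : Fin I.m → Fin I.n → ℕ) (f : Fin I.n) : ℕ :=
  ∑ w, I.firmVal f w * μ w f

/-- Nash social welfare: the geometric mean of the utilities of all `n + m` agents. -/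
noncomputable def nashWelfare (I : MatchingInstance) (μ : Fin I.m → Fin I.n → ℕ) : ℝ :=
  ((∏ w, (I.workerUtility μ w : ℝ)) * ∏ f, (I.firmUtility μ f : ℝ)) ^
    ((1 : ℝ) / ((I.n : ℝ) + (I.m : ℝ)))

/-- Some matching of the instance has nonzero Nash welfare. -/
def HasNonzeroNash (I : MatchingInstance) : Prop :=
  ∃ μ : Fin I.m → Fin I.n → ℕ, I.IsMatching μ ∧ I.nashWelfare μ ≠ 0

/-- The instance written as a list of numbers: `m`, `n`, the capacities, the workers' values
(worker by worker), the firms' values (firm by firm). -/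
def encode (I : MatchingInstance) : List ℕ :=
  I.m :: I.n :: (List.ofFn I.cap
    ++ (List.ofFn fun w => List.ofFn (I.workerVal w)).flatten
    ++ (List.ofFn fun f => List.ofFn (I.firmVal f)).flatten)

end MatchingInstance

/-! ## Random access machine programs and their running time

The machine has registers and arrays (indexed memory banks), all holding natural numbers. A program
is a finite text: it mentions finitely many registers and arrays. The only arithmetic operations
are addition and truncated subtraction, each charged one unit. There is no multiplication, so one
step of a fixed program lengthens the numbers in memory by at most a constant number of bits, and
polynomial time on this machine is polynomial time on Turing machines. -/

namespace RAM

/-- Expressions: literals, registers, array cells with a computed index, sums and differences. -/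
inductive Expr where
  | lit (c : ℕ) : Expr
  | reg (x : ℕ) : Expr
  | read (a : ℕ) (i : Expr) : Expr
  | add (e₁ e₂ : Expr) : Expr
  | sub (e₁ e₂ : Expr) : Expr

/-- Programs: assignment to a register, assignment to an array cell with a computed index,
sequencing, conditionals and loops whose tests have the form `e₁ < e₂`. -/
inductive Prog where
  | skip : Prog
  | assign (x : ℕ) (e : Expr) : Prog
  | store (a : ℕ) (i e : Expr) : Prog
  | seq (p q : Prog) : Prog
  | ifLt (e₁ e₂ : Expr) (p q : Prog) : Prog
  | whileLt (e₁ e₂ : Expr) (p : Prog) : Prog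

/-- The contents of the registers and of the arrays. -/
structure State where
  reg : ℕ → ℕ
  arr : ℕ → ℕ → ℕ

namespace State

/-- Overwrite register `x`. -/
def setReg (s : State) (x v : ℕ) : State :=
  { s with reg := Function.update s.reg x v }

/-- Overwrite cell `i` of array `a`. -/
def setArr (s : State) (a i v : ℕ) : State :=
  { s with arr := Function.update s.arr a (Function.update (s.arr a) i v) }

/-- The initial state: the input numbers are in array `0`, everything else is zero. -/
def init (l : List ℕ) : State where
  reg := fun _ => 0
  arr := fun a i => if a = 0 then l.getD i 0 else 0

end State

namespace Expr

/-- The value of an expression. -/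
def eval (s : State) : Expr → ℕ
  | lit c => c
  | reg x => s.reg x
  | read a i => s.arr a (i.eval s)
  | add e₁ e₂ => e₁.eval s + e₂.eval s
  | sub e₁ e₂ => e₁.eval s - e₂.eval s

/-- The cost of evaluating an expression: one unit for each operation and each access. -/
def cost : Expr → ℕ
  | lit _ => 1
  | reg _ => 1
  | read _ i => i.cost + 1
  | add e₁ e₂ => e₁.cost + e₂.cost + 1
  | sub e₁ e₂ => e₁.cost + e₂.cost + 1

end Expr

/-- `Exec p s t s'`: program `p` started in state `s` halts after exactly `t` units of time, in
state `s'`. -/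
inductive Exec : Prog → State → ℕ → State → Prop where
  | skip (s : State) : Exec Prog.skip s 1 s
  | assign (s : State) (x : ℕ) (e : Expr) :
      Exec (Prog.assign x e) s (e.cost + 1) (s.setReg x (e.eval s))
  | store (s : State) (a : ℕ) (i e : Expr) :
      Exec (Prog.store a i e) s (i.cost + e.cost + 1) (s.setArr a (i.eval s) (e.eval s))
  | seq {p q : Prog} {s s' s'' : State} {t t' : ℕ} (hp : Exec p s t s') (hq : Exec q s' t' s'') :
      Exec (Prog.seq p q) s (t + t') s''
  | ifTrue {e₁ e₂ : Expr} {p q : Prog} {s s' : State} {t : ℕ}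
      (h : e₁.eval s < e₂.eval s) (hp : Exec p s t s') :
      Exec (Prog.ifLt e₁ e₂ p q) s (e₁.cost + e₂.cost + 1 + t) s'
  | ifFalse {e₁ e₂ : Expr} {p q : Prog} {s s' : State} {t : ℕ}
      (h : ¬ e₁.eval s < e₂.eval s) (hq : Exec q s t s') :
      Exec (Prog.ifLt e₁ e₂ p q) s (e₁.cost + e₂.cost + 1 + t) s'
  | whileTrue {e₁ e₂ : Expr} {p : Prog} {s s' s'' : State} {t t' : ℕ}
      (h : e₁.eval s < e₂.eval s) (hp : Exec p s t s')
      (hw : Exec (Prog.whileLt e₁ e₂ p) s' t' s'') :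
      Exec (Prog.whileLt e₁ e₂ p) s (e₁.cost + e₂.cost + 1 + t + t') s''
  | whileFalse {e₁ e₂ : Expr} {p : Prog} {s : State} (h : ¬ e₁.eval s < e₂.eval s) :
      Exec (Prog.whileLt e₁ e₂ p) s (e₁.cost + e₂.cost + 1) s

/-- The machine is deterministic, so running time and output of a program are well defined. -/
theorem Exec.det {p : Prog} {s s₁ s₂ : State} {t₁ t₂ : ℕ} (h₁ : Exec p s t₁ s₁)
    (h₂ : Exec p s t₂ s₂) : t₁ = t₂ ∧ s₁ = s₂ := by
  induction h₁ generalizing t₂ s₂ with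
  | skip | assign | store => cases h₂; exact ⟨rfl, rfl⟩
  | seq _ _ ihp ihq =>
    cases h₂ with
    | seq hp hq =>
      obtain ⟨rfl, rfl⟩ := ihp hp
      obtain ⟨rfl, rfl⟩ := ihq hq
      exact ⟨rfl, rfl⟩
  | ifTrue h _ ih =>
    cases h₂ with
    | ifTrue _ hp => obtain ⟨rfl, rfl⟩ := ih hp; exact ⟨rfl, rfl⟩
    | ifFalse h' _ => exact absurd h h'
  | ifFalse h _ ih =>
    cases h₂ with
    | ifTrue h' _ => exact absurd h' h
    | ifFalse _ hq => obtain ⟨rfl, rfl⟩ := ih hq; exact ⟨rfl, rfl⟩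
  | whileTrue h _ _ ihp ihw =>
    cases h₂ with
    | whileTrue _ hp hw =>
      obtain ⟨rfl, rfl⟩ := ihp hp
      obtain ⟨rfl, rfl⟩ := ihw hw
      exact ⟨rfl, rfl⟩
    | whileFalse h' => exact absurd h h'
  | whileFalse h =>
    cases h₂ with
    | whileTrue h' _ _ => exact absurd h' h
    | whileFalse _ => exact ⟨rfl, rfl⟩

/-- The bit length of an input: the total length of the binary expansions of its numbers, plus one
separator for each number. -/
def bitLength (l : List ℕ) : ℕ :=
  (l.map fun x => x.size + 1).sum

/-- `DecidesInTime p enc P T`: on the encoding of every `a`, program `p` halts within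
`T (bit length of the input)` units of time, with `1` in register `0` if `P a` holds and with `0`
in register `0` otherwise. -/
def DecidesInTime {α : Type*} (p : Prog) (enc : α → List ℕ) (P : α → Prop) (T : ℕ → ℕ) : Prop :=
  ∀ a, ∃ t s', Exec p (State.init (enc a)) t s' ∧ t ≤ T (bitLength (enc a)) ∧
    (P a → s'.reg 0 = 1) ∧ (¬ P a → s'.reg 0 = 0)

/-- `P` is decidable in polynomial time, with instances written as `enc` prescribes. -/
def PolyTimeDecidable {α : Type*} (enc : α → List ℕ) (P : α → Prop) : Prop :=
  ∃ (p : Prog) (T : Polynomial ℕ), DecidesInTime p enc P fun k => T.eval k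

end RAM

/-! A product of natural numbers is nonzero exactly if every factor is, so only the signs of the
values matter: each worker must go to a firm she values, within capacities, and each firm must
receive some worker it values (`hasNonzeroNash_iff`).

This is a bipartite perfect matching problem with N = n(m+1) slots and N bidders. A slot of rank k
at firm f accepts a worker who values f only if k is below the capacity of f, and rank 0 also
requires that f value the worker. Dummy bidders accept every slot of positive rank. Since a perfect
matching fills all slots, each slot of rank 0 goes to a worker, which is the demand of the firm.
Using m+1 slots per firm, not m, keeps this demand present when m = 0.

The matching is found by an auction: an unmatched bidder takes a cheapest acceptable slot, raises
its price by one and evicts the owner. Thus no owner's slot is more than one unit dearer than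
another slot acceptable to that owner (`Auction.Inv.bid`). If a bidder faces only prices of at least
N+2, a vacant price level exposes a violation of Hall's condition
(`Auction.Inv.not_hasPerfectMatching`). Prices stay at most N+2, so there are O(N²) rounds, each
scanning N slots. For n > 0 the input has at least N entries, so the time is cubic in the input
length. -/

namespace MatchingInstance

/-! ### Positive welfare as an assignment condition. -/

/-- Some matching has nonzero Nash welfare exactly if the workers can be assigned to firms so that
every worker values her firm, capacities are respected, and every firm values one of its workers. -/
theorem hasNonzeroNash_iff (I : MatchingInstance) :
    I.HasNonzeroNash ↔ ∃ g : Fin I.m → Fin I.n, (∀ w, 0 < I.workerVal w (g w)) ∧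
      (∀ f, (Finset.univ.filter fun w => g w = f).card ≤ I.cap f) ∧
      ∀ f, ∃ w, g w = f ∧ 0 < I.firmVal f w := by
  constructor
  · rintro ⟨μ, hμ, hne⟩
    have hprod : (∏ w, (I.workerUtility μ w : ℝ)) * ∏ f, (I.firmUtility μ f : ℝ) ≠ 0 := by
      intro h0
      apply hne
      unfold nashWelfare
      rw [h0]
      apply Real.zero_rpow
      -- With no agents the exponent would be 1/0 = 0 and 0 ^ 0 = 1; but a vanishing product has a
      -- factor, hence there is an agent.
      have : I.n + I.m ≠ 0 := by
        intro h
        rcases mul_eq_zero.1 h0 with h1 | h1 <;>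
          obtain ⟨i, -, -⟩ := Finset.prod_eq_zero_iff.1 h1 <;> have := i.2 <;> omega
      have : ((I.n : ℝ) + (I.m : ℝ)) ≠ 0 := by exact_mod_cast this
      positivity
    have hw : ∀ w, ∃ f, I.workerVal w f * μ w f ≠ 0 := by
      intro w
      have := Finset.prod_ne_zero_iff.1 (left_ne_zero_of_mul hprod) w (Finset.mem_univ _)
      have h2 : I.workerUtility μ w ≠ 0 := by exact_mod_cast this
      obtain ⟨f, -, hf⟩ := Finset.exists_ne_zero_of_sum_ne_zero h2
      exact ⟨f, hf⟩
    have hf : ∀ f, ∃ w, I.firmVal f w * μ w f ≠ 0 := by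
      intro f
      have := Finset.prod_ne_zero_iff.1 (right_ne_zero_of_mul hprod) f (Finset.mem_univ _)
      have h2 : I.firmUtility μ f ≠ 0 := by exact_mod_cast this
      obtain ⟨w, -, hw⟩ := Finset.exists_ne_zero_of_sum_ne_zero h2
      exact ⟨w, hw⟩
    choose g hg using hw
    refine ⟨g, fun w => Nat.pos_of_ne_zero (left_ne_zero_of_mul (hg w)), fun f => ?_, fun f => ?_⟩
    · refine le_trans ?_ (hμ.firm_le f)
      rw [Finset.card_filter]
      refine Finset.sum_le_sum fun w _ => ?_
      split_ifs with h
      · have := right_ne_zero_of_mul (hg w)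
        rw [h] at this
        omega
      · omega
    · obtain ⟨w, hwf⟩ := hf f
      refine ⟨w, ?_, Nat.pos_of_ne_zero (left_ne_zero_of_mul hwf)⟩
      -- Worker `w` would be matched with both `g w` and `f`, against her bound of one firm.
      by_contra hne'
      have h1 := right_ne_zero_of_mul hwf
      have h2 := right_ne_zero_of_mul (hg w)
      have h3 := Finset.sum_le_sum_of_subset (f := fun f => μ w f)
        (Finset.subset_univ {g w, f})
      rw [Finset.sum_pair hne'] at h3
      have := hμ.worker_le w
      omega
  · rintro ⟨g, hg, hcap, hfirm⟩
    refine ⟨fun w f => if g w = f then 1 else 0, ⟨fun w f => ?_, fun w => ?_, fun f => ?_⟩, ?_⟩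
    · split_ifs <;> simp
    · simp
    · rw [← Finset.card_filter]
      exact hcap f
    · unfold nashWelfare
      refine (Real.rpow_pos_of_pos (mul_pos ?_ ?_) _).ne'
      · refine Finset.prod_pos fun w _ => ?_
        simpa [workerUtility] using hg w
      · refine Finset.prod_pos fun f _ => ?_
        obtain ⟨w, hw, hpos⟩ := hfirm f
        have : 0 < I.firmUtility (fun w f => if g w = f then 1 else 0) f :=
          Finset.sum_pos' (fun _ _ => Nat.zero_le _) ⟨w, Finset.mem_univ _, by simpa [hw] using hpos⟩
        exact_mod_cast this

/-! ### Positions of the entries in the encoded instance. -/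

theorem getElem?_flatten_ofFn {m n : ℕ} (v : Fin m → Fin n → ℕ) (i : Fin m) (j : Fin n) :
    (List.ofFn fun i => List.ofFn (v i)).flatten[i.1 * n + j.1]? = some (v i j) := by
  have hlt : ∀ (i : Fin m) (j : Fin n), i.1 * n + j.1 < m * n := by
    intro i j
    have := Nat.mul_le_mul_right n (Nat.succ_le_of_lt i.2)
    have := j.2
    rw [Nat.succ_mul] at *
    omega
  have hn : 0 < n := j.pos
  have hv : ∀ i j, v (Fin.divNat ⟨i.1 * n + j.1, hlt i j⟩) (Fin.modNat ⟨i.1 * n + j.1, hlt i j⟩)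
      = v i j := by
    intro i j
    congr 1
    · ext
      simp [Fin.divNat, Nat.mul_comm i.1 n, Nat.mul_add_div hn, Nat.div_eq_of_lt j.2]
    · ext
      simp [Fin.modNat, Nat.mul_comm i.1 n, Nat.mod_eq_of_lt j.2]
  have h : (List.ofFn fun i => List.ofFn (v i)).flatten
      = List.ofFn fun k : Fin (m * n) => v k.divNat k.modNat := by
    rw [List.ofFn_mul]
    simp only [hv]
  rw [h, List.getElem?_ofFn, dif_pos (hlt i j), hv]

theorem length_flatten_ofFn {m n : ℕ} (v : Fin m → Fin n → ℕ) :
    (List.ofFn fun i => List.ofFn (v i)).flatten.length = m * n := by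
  simp [List.length_flatten, List.map_ofFn, Function.comp_def]

theorem encode_cap (I : MatchingInstance) (f : Fin I.n) :
    I.encode.getD (2 + f) 0 = I.cap f := by
  have : 2 + f.1 = f.1 + 1 + 1 := by omega
  rw [List.getD_eq_getElem?_getD, encode, this, List.getElem?_cons_succ, List.getElem?_cons_succ,
    List.append_assoc, List.getElem?_append_left (by simp)]
  simp

/-- The capacities fill a row of length `n` starting at position 2, so the worker with bidder number
`c = w + 1` has her values in the row starting at `2 + c * n`. -/
theorem encode_workerVal (I : MatchingInstance) (w : Fin I.m) (f : Fin I.n) :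
    I.encode.getD (2 + (w + 1) * I.n + f) 0 = I.workerVal w f := by
  have h : 2 + (w.1 + 1) * I.n + f.1 = I.n + (w.1 * I.n + f.1) + 1 + 1 := by ring
  have hlt : w.1 * I.n + f.1 < I.m * I.n := by
    have := Nat.mul_le_mul_right I.n (Nat.succ_le_of_lt w.2)
    have := f.2
    rw [Nat.succ_mul] at *
    omega
  rw [List.getD_eq_getElem?_getD, encode, h, List.getElem?_cons_succ, List.getElem?_cons_succ,
    List.append_assoc, List.getElem?_append_right (by simp),
    List.getElem?_append_left (by rw [length_flatten_ofFn]; simpa using hlt),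
    List.length_ofFn, Nat.add_sub_cancel_left, getElem?_flatten_ofFn]
  rfl

/-- The base address is one less than the start of the firm's row, because workers enter as bidders
numbered from 1. -/
theorem encode_firmVal (I : MatchingInstance) (f : Fin I.n) (w : Fin I.m) :
    I.encode.getD (1 + I.n + I.m * I.n + f * I.m + (w + 1)) 0 = I.firmVal f w := by
  have h : 1 + I.n + I.m * I.n + f.1 * I.m + (w.1 + 1)
      = (I.n + I.m * I.n) + (f.1 * I.m + w.1) + 1 + 1 := by ring
  rw [List.getD_eq_getElem?_getD, encode, h, List.getElem?_cons_succ, List.getElem?_cons_succ,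
    List.getElem?_append_right (by simp [length_flatten_ofFn, -List.length_flatten]),
    List.length_append, length_flatten_ofFn,
    List.length_ofFn, Nat.add_sub_cancel_left, getElem?_flatten_ofFn]
  rfl

theorem length_encode (I : MatchingInstance) :
    I.encode.length = 2 + I.n + 2 * (I.m * I.n) := by
  simp only [encode, List.length_cons, List.length_append, length_flatten_ofFn, List.length_ofFn]
  ring

end MatchingInstance

theorem RAM.length_le_bitLength (l : List ℕ) : l.length ≤ RAM.bitLength l := by
  induction l with
  | nil => simp
  | cons a l ih => simp only [RAM.bitLength, List.map_cons, List.sum_cons, List.length_cons] at *; omega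

/-! ## Perfect matchings by auction -/

namespace Auction

/-- The bidders `1, …, N` can be matched with the slots `0, …, N - 1` along `Adj`. -/
def HasPerfectMatching (N : ℕ) (Adj : ℕ → ℕ → Prop) : Prop :=
  ∃ σ : ℕ → ℕ, (∀ c, 1 ≤ c → c ≤ N → σ c < N ∧ Adj c (σ c)) ∧ Set.InjOn σ (Set.Icc 1 N)

/-- The state of an auction after the bidders `1, …, i` have entered: `own s` is the bidder holding
slot `s` (or `0`), `price s` its price, and `cur` the bidder who is to bid next (or `0`). -/
structure Inv (N : ℕ) (Adj : ℕ → ℕ → Prop) (own price : ℕ → ℕ) (i cur : ℕ) : Prop where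
  entered_le : i ≤ N
  own_le : ∀ s < N, own s ≤ i
  own_inj : ∀ s < N, ∀ t < N, own s ≠ 0 → own s = own t → s = t
  cur_le : cur ≤ i
  cur_free : cur ≠ 0 → ∀ s < N, own s ≠ cur
  covered : ∀ c, 1 ≤ c → c ≤ i → c = cur ∨ ∃ s < N, own s = c
  price_free : ∀ s < N, own s = 0 → price s = 0
  adj : ∀ s < N, own s ≠ 0 → Adj (own s) s
  slack : ∀ s < N, own s ≠ 0 → ∀ t < N, Adj (own s) t → price s ≤ price t + 1
  price_le : ∀ s < N, price s ≤ N + 2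

variable {N : ℕ} {Adj : ℕ → ℕ → Prop} {own price : ℕ → ℕ} {i cur : ℕ}

theorem Inv.start (N : ℕ) (Adj : ℕ → ℕ → Prop) : Inv N Adj (fun _ => 0) (fun _ => 0) 0 0 := by
  constructor <;> simp
  omega

theorem Inv.enter (h : Inv N Adj own price i 0) (hi : i < N) :
    Inv N Adj own price (i + 1) (i + 1) where
  entered_le := hi
  own_le s hs := (h.own_le s hs).trans (Nat.le_succ i)
  own_inj := h.own_inj
  cur_le := le_rfl
  cur_free _ s hs := by have := h.own_le s hs; omega
  covered c h1 h2 := by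
    rcases Nat.lt_or_ge i c with h3 | h3
    · left; omega
    · right
      rcases h.covered c h1 h3 with h4 | h4
      · omega
      · exact h4
  price_free := h.price_free
  adj := h.adj
  slack := h.slack
  price_le := h.price_le

/-- The slack condition survives because the new owner chose a cheapest acceptable slot, which one
increment puts at most one above the others, while for all other owners only competing prices can
rise. Owned slots never become free, so free slots keep price 0. The evicted owner is the next
bidder; evicting 0 means that nobody is waiting. -/
theorem Inv.bid (h : Inv N Adj own price i cur) (hcur : cur ≠ 0) {b : ℕ} (hb : b < N)
    (hadj : Adj cur b) (hmin : ∀ t < N, Adj cur t → price b ≤ price t) (hlt : price b < N + 2) :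
    Inv N Adj (Function.update own b cur) (Function.update price b (price b + 1)) i (own b) := by
  have hmono : ∀ t, price t ≤ Function.update price b (price b + 1) t := by
    intro t
    rcases eq_or_ne t b with rfl | ht
    · simp
    · simp [ht]
  refine ⟨h.entered_le, ?_, ?_, h.own_le b hb, ?_, ?_, ?_, ?_, ?_, ?_⟩
  · intro s hs
    rcases eq_or_ne s b with rfl | hsb
    · simpa using h.cur_le
    · simpa [hsb] using h.own_le s hs
  · intro s hs t ht hs0 hst
    rcases eq_or_ne s b with rfl | hsb <;> rcases eq_or_ne t s with rfl | hts
    · rfl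
    · simp only [Function.update_self, Function.update_of_ne hts] at hst
      exact absurd hst.symm (h.cur_free hcur t ht)
    · rfl
    · rcases eq_or_ne t b with rfl | htb
      · simp only [Function.update_self, Function.update_of_ne hsb] at hst
        exact absurd hst (h.cur_free hcur s hs)
      · simp only [Function.update_of_ne htb, Function.update_of_ne hsb] at hst hs0
        exact h.own_inj s hs t ht hs0 hst
  · intro hb0 s hs
    rcases eq_or_ne s b with rfl | hsb
    · simpa using (h.cur_free hcur s hs).symm
    · simp only [Function.update_of_ne hsb]
      intro hsb'
      exact hsb (h.own_inj b hb s hs hb0 hsb'.symm).symm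
  · intro c h1 h2
    rcases h.covered c h1 h2 with rfl | ⟨s, hs, rfl⟩
    · exact Or.inr ⟨b, hb, by simp⟩
    · rcases eq_or_ne s b with rfl | hsb
      · exact Or.inl rfl
      · exact Or.inr ⟨s, hs, by simp [hsb]⟩
  · intro s hs
    rcases eq_or_ne s b with rfl | hsb
    · simp [hcur]
    · simpa [hsb] using h.price_free s hs
  · intro s hs
    rcases eq_or_ne s b with rfl | hsb
    · simp [hadj]
    · simpa [hsb] using h.adj s hs
  · intro s hs hs0 t ht hst
    have := hmono t
    rcases eq_or_ne s b with rfl | hsb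
    · simp only [Function.update_self] at *
      have := hmin t ht hst
      omega
    · simp only [Function.update_of_ne hsb] at *
      have := h.slack s hs hs0 t ht hst
      omega
  · intro s hs
    rcases eq_or_ne s b with rfl | hsb
    · simp; omega
    · simpa [hsb] using h.price_le s hs

theorem Inv.hasPerfectMatching (h : Inv N Adj own price N 0) : HasPerfectMatching N Adj := by
  have : ∀ c, ∃ s, 1 ≤ c → c ≤ N → s < N ∧ own s = c := by
    intro c
    by_cases hc : 1 ≤ c ∧ c ≤ N
    · rcases h.covered c hc.1 hc.2 with h0 | ⟨s, hs, hsc⟩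
      · omega
      · exact ⟨s, fun _ _ => ⟨hs, hsc⟩⟩
    · exact ⟨0, fun h1 h2 => absurd ⟨h1, h2⟩ hc⟩
  choose σ hσ using this
  refine ⟨σ, fun c h1 h2 => ⟨(hσ c h1 h2).1, ?_⟩, fun c hc d hd hcd => ?_⟩
  · have := h.adj (σ c) (hσ c h1 h2).1
    rw [(hσ c h1 h2).2] at this
    exact this (by omega)
  · rw [← (hσ c hc.1 hc.2).2, ← (hσ d hd.1 hd.2).2, hcd]

/-- If every slot acceptable to a bidding bidder has a high price, then some price level is vacant,
and the slots above it are too few for the bidders who accept nothing else. -/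
theorem Inv.not_hasPerfectMatching (h : Inv N Adj own price i cur) (hcur : cur ≠ 0)
    (hhigh : ∀ t < N, Adj cur t → N + 2 ≤ price t) : ¬ HasPerfectMatching N Adj := by
  rintro ⟨σ, hσ, hinj⟩
  -- The levels 1, …, N+1 outnumber the N slots. As `j` is at least 1, every slot priced above it
  -- has a nonzero price and therefore an owner.
  obtain ⟨j, hj, hvac⟩ : ∃ j ∈ Finset.Icc 1 (N + 1), j ∉ (Finset.range N).image price :=
    Finset.exists_mem_notMem_of_card_lt_card
      (lt_of_le_of_lt Finset.card_image_le (by simp))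
  rw [Finset.mem_Icc] at hj
  have hvac' : ∀ s < N, price s ≠ j := fun s hs hsj =>
    hvac (Finset.mem_image.2 ⟨s, Finset.mem_range.2 hs, hsj⟩)
  set T := (Finset.range N).filter fun s => j < price s with hT
  have hTmem : ∀ s, s ∈ T ↔ s < N ∧ j < price s := by simp [hT]
  have hown : ∀ s ∈ T, own s ≠ 0 := by
    intro s hs h0
    have := h.price_free s ((hTmem s).1 hs).1 h0
    have := ((hTmem s).1 hs).2
    omega
  have hcard : (insert cur (T.image own)).card = T.card + 1 := by
    rw [Finset.card_insert_of_notMem, Finset.card_image_of_injOn]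
    · intro s hs t ht hst
      exact h.own_inj s ((hTmem s).1 hs).1 t ((hTmem t).1 ht).1 (hown s hs) hst
    · intro hmem
      obtain ⟨s, hs, hsc⟩ := Finset.mem_image.1 hmem
      exact h.cur_free hcur s ((hTmem s).1 hs).1 hsc
  have hIcc : ∀ c ∈ insert cur (T.image own), 1 ≤ c ∧ c ≤ N := by
    intro c hc
    rcases Finset.mem_insert.1 hc with rfl | hc
    · exact ⟨by omega, h.cur_le.trans h.entered_le⟩
    · obtain ⟨s, hs, rfl⟩ := Finset.mem_image.1 hc
      exact ⟨Nat.pos_of_ne_zero (hown s hs),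
        (h.own_le s ((hTmem s).1 hs).1).trans h.entered_le⟩
  -- An owner of a slot priced above `j` accepts only slots priced at least `j`, by slack, hence
  -- above `j`, as `j` is vacant. For `cur` the high prices give the same. So `σ` would inject |T| +
  -- 1 bidders into `T`.
  have hle : (insert cur (T.image own)).card ≤ T.card := by
    refine Finset.card_le_card_of_injOn σ (fun c hc => ?_) fun c hc d hd hcd =>
      hinj (hIcc c hc) (hIcc d hd) hcd
    obtain ⟨h1, h2⟩ := hσ c (hIcc c hc).1 (hIcc c hc).2
    refine (hTmem _).2 ⟨h1, ?_⟩
    rcases Finset.mem_insert.1 hc with rfl | hc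
    · have := hhigh _ h1 h2
      omega
    · obtain ⟨s, hs, rfl⟩ := Finset.mem_image.1 hc
      have h3 := h.slack s ((hTmem s).1 hs).1 (hown s hs) _ h1 h2
      have h4 := ((hTmem s).1 hs).2
      have h5 := hvac' _ h1
      omega
  omega

end Auction

/-! ## Nonzero Nash welfare as a perfect matching problem

Every firm gets `m + 1` slots, the first of which has to go to a worker whom the firm values. The
first `m` bidders are the workers, all others are dummies taking the remaining slots. -/

/-- Bidder `c` accepts slot `s`, for an instance with `m` workers and `n` firms written in `a`. -/
def SlotAdj (a : ℕ → ℕ) (m n c s : ℕ) : Prop :=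
  if c ≤ m then
    s % (m + 1) < a (2 + s / (m + 1)) ∧ 0 < a (2 + c * n + s / (m + 1)) ∧
      0 < s % (m + 1) + a (1 + n + m * n + s / (m + 1) * m + c)
  else 0 < s % (m + 1)

namespace MatchingInstance

theorem slot_div {m k : ℕ} (f : ℕ) (hk : k < m + 1) : (f * (m + 1) + k) / (m + 1) = f := by
  rw [Nat.mul_comm, Nat.mul_add_div (Nat.succ_pos m), Nat.div_eq_of_lt hk, Nat.add_zero]

theorem slot_mod {m k : ℕ} (f : ℕ) (hk : k < m + 1) : (f * (m + 1) + k) % (m + 1) = k := by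
  rw [Nat.mul_comm, Nat.mul_add_mod, Nat.mod_eq_of_lt hk]

theorem slot_lt {m n f k : ℕ} (hf : f < n) (hk : k < m + 1) :
    f * (m + 1) + k < n * (m + 1) := by
  have := Nat.mul_le_mul_right (m + 1) (Nat.succ_le_of_lt hf)
  rw [Nat.succ_mul] at this
  omega

/-- Positivity of the sum of rank and firm value expresses the implication that rank 0 requires a
positive value, in a form the machine tests by one comparison. -/
theorem slotAdj_worker (I : MatchingInstance) (w : Fin I.m) (f : Fin I.n) (k : ℕ)
    (hk : k < I.m + 1) :
    SlotAdj (fun i => I.encode.getD i 0) I.m I.n (w + 1) (f * (I.m + 1) + k) ↔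
      k < I.cap f ∧ 0 < I.workerVal w f ∧ (k = 0 → 0 < I.firmVal f w) := by
  have hw : w.1 + 1 ≤ I.m := w.2
  rw [SlotAdj, if_pos hw, slot_div _ hk, slot_mod _ hk, encode_cap, encode_workerVal,
    encode_firmVal]
  refine and_congr_right fun _ => and_congr_right fun _ => ?_
  omega

theorem hasNonzeroNash_of_hasPerfectMatching (I : MatchingInstance)
    (h : Auction.HasPerfectMatching (I.n * (I.m + 1))
      (SlotAdj (fun i => I.encode.getD i 0) I.m I.n)) (hn : 0 < I.n) : I.HasNonzeroNash := by
  obtain ⟨σ, hσ, hinj⟩ := h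
  have hmN : I.m ≤ I.n * (I.m + 1) :=
    (Nat.le_succ _).trans (Nat.le_mul_of_pos_left _ hn)
  have hdiv : ∀ s, s < I.n * (I.m + 1) → s / (I.m + 1) < I.n := fun s hs =>
    Nat.div_lt_of_lt_mul (by rwa [Nat.mul_comm])
  have hmod : ∀ s, s % (I.m + 1) < I.m + 1 := fun s => Nat.mod_lt _ (Nat.succ_pos _)
  have heq : ∀ s, s / (I.m + 1) * (I.m + 1) + s % (I.m + 1) = s := fun s => Nat.div_add_mod' _ _
  have hw : ∀ w : Fin I.m, σ (w + 1) < I.n * (I.m + 1) ∧ _ := fun w =>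
    hσ (w + 1) (by omega) (by have := w.2; omega)
  have hadj : ∀ (w : Fin I.m) (f : Fin I.n), f.1 = σ (w + 1) / (I.m + 1) →
      σ (w + 1) % (I.m + 1) < I.cap f ∧ 0 < I.workerVal w f ∧
        (σ (w + 1) % (I.m + 1) = 0 → 0 < I.firmVal f w) := by
    intro w f hf
    rw [← slotAdj_worker _ _ _ _ (hmod _), hf, heq]
    exact (hw w).2
  refine I.hasNonzeroNash_iff.2 ⟨fun w => ⟨σ (w + 1) / (I.m + 1), hdiv _ (hw w).1⟩,
    fun w => (hadj w _ rfl).2.1, fun f => ?_, fun f => ?_⟩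
  -- Workers at the same firm occupy slots of different ranks, all below the capacity.
  · rw [← Finset.card_range (I.cap f)]
    refine Finset.card_le_card_of_injOn (fun w => σ (w + 1) % (I.m + 1)) (fun w hwf => ?_)
      fun w hwf w' hwf' hww => ?_
    · simp only [Finset.coe_filter, Finset.mem_univ, true_and, Set.mem_ofPred_eq] at hwf
      simpa using (hadj w f (by rw [← hwf])).1
    · simp only [Finset.coe_filter, Finset.mem_univ, true_and, Set.mem_ofPred_eq] at hwf hwf'
      have hdd := congrArg Fin.val (hwf.trans hwf'.symm)
      dsimp only at hdd hww
      have hs : σ (w + 1) = σ (w' + 1) := by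
        rw [← heq (σ (w + 1)), ← heq (σ (w' + 1)), hdd, hww]
      have := hinj (x₁ := w.1 + 1) (x₂ := w'.1 + 1)
        ⟨by omega, by have := w.2; omega⟩ ⟨by omega, by have := w'.2; omega⟩ hs
      ext
      omega
  -- An injection of N bidders into N slots is onto, so the slot of rank 0 of `f` is taken, and
  -- dummies refuse it.
  · have himg : (Finset.Icc 1 (I.n * (I.m + 1))).image σ = Finset.range (I.n * (I.m + 1)) := by
      refine Finset.eq_of_subset_of_card_le (fun s hs => ?_) ?_
      · obtain ⟨c, hc, rfl⟩ := Finset.mem_image.1 hs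
        rw [Finset.mem_Icc] at hc
        exact Finset.mem_range.2 (hσ c hc.1 hc.2).1
      · rw [Finset.card_image_of_injOn (by simpa using hinj)]
        simp
    have hs : f.1 * (I.m + 1) + 0 ∈ (Finset.Icc 1 (I.n * (I.m + 1))).image σ := by
      rw [himg, Finset.mem_range]
      exact slot_lt f.2 (Nat.succ_pos _)
    obtain ⟨c, hc, hcs⟩ := Finset.mem_image.1 hs
    rw [Finset.mem_Icc] at hc
    by_cases hcm : c ≤ I.m
    · obtain ⟨w, rfl⟩ : ∃ w : Fin I.m, c = w + 1 := ⟨⟨c - 1, by omega⟩, by simp; omega⟩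
      have h0 : σ (w + 1) % (I.m + 1) = 0 := by rw [hcs, slot_mod _ (Nat.succ_pos _)]
      have hf : σ (w + 1) / (I.m + 1) = f := by rw [hcs, slot_div _ (Nat.succ_pos _)]
      exact ⟨w, Fin.ext hf, (hadj w f hf.symm).2.2 h0⟩
    · have := (hσ c hc.1 hc.2).2
      rw [SlotAdj, if_neg hcm, hcs, slot_mod _ (Nat.succ_pos _)] at this
      omega

theorem hasPerfectMatching_of_hasNonzeroNash (I : MatchingInstance) (h : I.HasNonzeroNash) :
    Auction.HasPerfectMatching (I.n * (I.m + 1))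
      (SlotAdj (fun i => I.encode.getD i 0) I.m I.n) := by
  obtain ⟨g, hg, hcap, hfirm⟩ := I.hasNonzeroNash_iff.1 h
  choose top htop htopval using hfirm
  -- Number the workers of each firm from 0 with the valued worker `top f` first, since she has to
  -- fill the slot of rank 0.
  have hrank : ∀ f, ∃ r : {w // g w = f} ≃
      Finset.range (Finset.univ.filter fun w => g w = f).card, (r ⟨top f, htop f⟩ : ℕ) = 0 := by
    intro f
    have hpos : 0 < (Finset.univ.filter fun w => g w = f).card :=
      Finset.card_pos.2 ⟨top f, by simp [htop f]⟩
    obtain ⟨r, hr⟩ := Finset.exists_equiv_extend_of_card_eq (α := {w // g w = f})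
      (t := Finset.range (Finset.univ.filter fun w => g w = f).card)
      (by rw [Finset.card_range, Fintype.card_subtype])
      (s := {⟨top f, htop f⟩}) (f := fun _ => 0) (by
        intro k hk
        obtain ⟨-, -, rfl⟩ := Finset.mem_image.1 hk
        exact Finset.mem_range.2 hpos) (by simp)
    exact ⟨r, hr _ (Finset.mem_singleton_self _)⟩
  choose r hr using hrank
  set rank : Fin I.m → ℕ := fun w => (r (g w) ⟨w, rfl⟩ : ℕ) with hrankdef
  have rank_eq : ∀ w f (hf : g w = f), rank w = r f ⟨w, hf⟩ := by
    rintro w f rfl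
    rfl
  have rank_lt : ∀ w, rank w < (Finset.univ.filter fun w' => g w' = g w).card := fun w =>
    Finset.mem_range.1 (r (g w) ⟨w, rfl⟩).2
  have rank_lt' : ∀ w, rank w < I.m + 1 := fun w =>
    (rank_lt w).trans_le ((Finset.card_le_univ _).trans (by simp))
  have rank_top : ∀ f, rank (top f) = 0 := fun f => by rw [rank_eq _ f (htop f), hr]
  set slot : Fin I.m → ℕ := fun w => (g w).1 * (I.m + 1) + rank w with hslot
  have slot_inj : Function.Injective slot := by
    intro w w' hww
    have h1 : g w = g w' := by
      ext
      rw [← slot_div (g w).1 (rank_lt' w), ← slot_div (g w').1 (rank_lt' w')]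
      exact congrArg (· / (I.m + 1)) hww
    have h2 : rank w = rank w' := by
      rw [← slot_mod (g w).1 (rank_lt' w), ← slot_mod (g w').1 (rank_lt' w')]
      exact congrArg (· % (I.m + 1)) hww
    rw [rank_eq w _ h1, rank_eq w' _ rfl] at h2
    exact congrArg Subtype.val ((r (g w')).injective (Subtype.ext h2))
  have slot_lt' : ∀ w, slot w < I.n * (I.m + 1) := fun w => slot_lt (g w).2 (rank_lt' w)
  set N := I.n * (I.m + 1) with hN
  have hmN : I.m ≤ N := by
    have := Fintype.card_le_of_injective (fun w => (⟨slot w, slot_lt' w⟩ : Fin N))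
      fun w w' hww => slot_inj (congrArg Fin.val hww)
    simpa using this
  -- The injective placement of the workers extends to a bijection of all bidders, indexed from 0 as
  -- `c - 1`, with all slots; the dummies take what remains.
  obtain ⟨e, he⟩ := Finset.exists_equiv_extend_of_card_eq (α := Fin N)
    (t := Finset.range N) (by simp) (s := Finset.univ.filter fun i : Fin N => i.1 < I.m)
    (f := fun i => if hi : i.1 < I.m then slot ⟨i, hi⟩ else 0)
    (by
      intro s hs
      obtain ⟨i, hi, rfl⟩ := Finset.mem_image.1 hs
      have hi' : i.1 < I.m := by simpa using hi
      rw [dif_pos hi']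
      exact Finset.mem_range.2 (slot_lt' _))
    (by
      intro i hi j hj hij
      have hi' : i.1 < I.m := by simpa using hi
      have hj' : j.1 < I.m := by simpa using hj
      simp only [dif_pos hi', dif_pos hj'] at hij
      have := slot_inj hij
      exact Fin.ext (Fin.mk.inj_iff.1 this))
  have he' : ∀ (i : Fin N) (hi : i.1 < I.m), (e i : ℕ) = slot ⟨i, hi⟩ := by
    intro i hi
    rw [he i (by simpa using hi), dif_pos hi]
  refine ⟨fun c => if hc : c - 1 < N then e ⟨c - 1, hc⟩ else 0, fun c h1 h2 => ?_,
    fun c hc d hd hcd => ?_⟩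
  · have hc : c - 1 < N := by omega
    simp only [dif_pos hc]
    refine ⟨Finset.mem_range.1 (e ⟨c - 1, hc⟩).2, ?_⟩
    by_cases hcm : c ≤ I.m
    · obtain ⟨w, rfl⟩ : ∃ w : Fin I.m, c = w + 1 := ⟨⟨c - 1, by omega⟩, by simp; omega⟩
      rw [he' _ (by simp)]
      have : SlotAdj (fun i => I.encode.getD i 0) I.m I.n (w + 1) (slot w) := by
        rw [hslot, slotAdj_worker _ _ _ _ (rank_lt' w)]
        refine ⟨(rank_lt w).trans_le (hcap _), hg w, fun h0 => ?_⟩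
        have hwt : w = top (g w) := by
          rw [← rank_top (g w), rank_eq w _ rfl, rank_eq (top (g w)) _ (htop (g w))] at h0
          exact congrArg Subtype.val ((r (g w)).injective (Subtype.ext h0))
        have := htopval (g w)
        rwa [← hwt] at this
      simpa using this
    · rw [SlotAdj, if_neg hcm]
      -- A dummy on a slot of rank 0 would share it with `top f`, against injectivity of `e`.
      by_contra h0
      have hlt := Finset.mem_range.1 (e ⟨c - 1, hc⟩).2
      have hdiv : (e ⟨c - 1, hc⟩ : ℕ) / (I.m + 1) < I.n :=
        Nat.div_lt_of_lt_mul (by rw [Nat.mul_comm]; exact hlt)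
      set f : Fin I.n := ⟨_, hdiv⟩ with hf
      have h3 : (e ⟨c - 1, hc⟩ : ℕ) = slot (top f) := by
        rw [hslot]
        simp only
        rw [htop, rank_top, hf]
        rw [← Nat.eq_zero_of_not_pos h0]
        exact (Nat.div_add_mod' _ _).symm
      rw [← he' ⟨(top f).1, (top f).2.trans_le hmN⟩ (top f).2] at h3
      have := congrArg Fin.val (e.injective (Subtype.ext h3))
      have := (top f).2
      dsimp only at *
      omega
  · have hc' : c - 1 < N := by have := hc.1; have := hc.2; omega
    have hd' : d - 1 < N := by have := hd.1; have := hd.2; omega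
    simp only [dif_pos hc', dif_pos hd'] at hcd
    have := congrArg Fin.val (e.injective (Subtype.ext hcd))
    have := hc.1
    have := hd.1
    dsimp only at *
    omega

end MatchingInstance

/-! ### Timed Hoare rules for the machine. -/

namespace RAM

/-- Started in `s`, program `p` halts within `T` units of time in a state satisfying `Q`. -/
def Runs (p : Prog) (s : State) (T : ℕ) (Q : State → Prop) : Prop :=
  ∃ t s', Exec p s t s' ∧ t ≤ T ∧ Q s'

theorem Runs.mono {p : Prog} {s : State} {T T' : ℕ} {Q Q' : State → Prop} (h : Runs p s T Q)
    (hT : T ≤ T') (hQ : ∀ s', Q s' → Q' s') : Runs p s T' Q' := by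
  obtain ⟨t, s', he, ht, hq⟩ := h
  exact ⟨t, s', he, ht.trans hT, hQ _ hq⟩

theorem Runs.seq {p q : Prog} {s : State} {T T' : ℕ} {Q R : State → Prop} (hp : Runs p s T Q)
    (hq : ∀ s', Q s' → Runs q s' T' R) : Runs (Prog.seq p q) s (T + T') R := by
  obtain ⟨t, s', he, ht, h⟩ := hp
  obtain ⟨t', s'', he', ht', h'⟩ := hq s' h
  exact ⟨t + t', s'', he.seq he', Nat.add_le_add ht ht', h'⟩

theorem Runs.ifLt {e₁ e₂ : Expr} {p q : Prog} {s : State} {T : ℕ} {Q : State → Prop}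
    (hp : e₁.eval s < e₂.eval s → Runs p s T Q) (hq : ¬ e₁.eval s < e₂.eval s → Runs q s T Q) :
    Runs (Prog.ifLt e₁ e₂ p q) s (e₁.cost + e₂.cost + 1 + T) Q := by
  by_cases h : e₁.eval s < e₂.eval s
  · obtain ⟨t, s', he, ht, hQ⟩ := hp h
    exact ⟨_, s', he.ifTrue h, Nat.add_le_add_left ht _, hQ⟩
  · obtain ⟨t, s', he, ht, hQ⟩ := hq h
    exact ⟨_, s', he.ifFalse h, Nat.add_le_add_left ht _, hQ⟩

/-- The variant `μ` strictly decreases, so there are at most `μ s` rounds and one more test that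
fails. -/
theorem Runs.whileLt {e₁ e₂ : Expr} {p : Prog} (J : State → Prop) (μ : State → ℕ) (C : ℕ)
    (hbody : ∀ s, J s → e₁.eval s < e₂.eval s → Runs p s C fun s' => J s' ∧ μ s' < μ s)
    {s : State} (hs : J s) :
    Runs (Prog.whileLt e₁ e₂ p) s ((μ s + 1) * (e₁.cost + e₂.cost + 1 + C))
      fun s' => J s' ∧ ¬ e₁.eval s' < e₂.eval s' := by
  induction hk : μ s using Nat.strong_induction_on generalizing s with
  | _ k ih =>
    by_cases h : e₁.eval s < e₂.eval s
    · obtain ⟨t, s', he, ht, hJ, hlt⟩ := hbody s hs h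
      obtain ⟨t', s'', he', ht', hQ⟩ := ih (μ s') (hk ▸ hlt) hJ rfl
      refine ⟨_, s'', he.whileTrue h he', ?_, hQ⟩
      have : (μ s' + 1) * (e₁.cost + e₂.cost + 1 + C) ≤ k * (e₁.cost + e₂.cost + 1 + C) :=
        Nat.mul_le_mul_right _ (by omega)
      rw [Nat.add_mul]
      omega
    · refine ⟨_, s, Exec.whileFalse h, ?_, hs, h⟩
      rw [Nat.add_mul]
      omega

/-- The weakest precondition of a program without loops. -/
def Prog.wp : Prog → (State → Prop) → State → Prop
  | .skip, Q, s => Q s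
  | .assign x e, Q, s => Q (s.setReg x (e.eval s))
  | .store a i e, Q, s => Q (s.setArr a (i.eval s) (e.eval s))
  | .seq p q, Q, s => p.wp (q.wp Q) s
  | .ifLt e₁ e₂ p q, Q, s =>
      (e₁.eval s < e₂.eval s → p.wp Q s) ∧ (¬ e₁.eval s < e₂.eval s → q.wp Q s)
  | .whileLt _ _ _, _, _ => False

/-- A bound for the running time of a program without loops. -/
def Prog.maxTime : Prog → ℕ
  | .skip => 1
  | .assign _ e => e.cost + 1
  | .store _ i e => i.cost + e.cost + 1
  | .seq p q => p.maxTime + q.maxTime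
  | .ifLt e₁ e₂ p q => e₁.cost + e₂.cost + 1 + max p.maxTime q.maxTime
  | .whileLt _ _ _ => 0

/-- This reduces loop-free code to symbolic evaluation with a numerical time bound. The value 0 of
`maxTime` at loops is harmless, since their `wp` is `False`. -/
theorem Prog.wp.runs {p : Prog} {Q : State → Prop} {s : State} (h : p.wp Q s) :
    Runs p s p.maxTime Q := by
  induction p generalizing s Q with
  | skip => exact ⟨1, s, Exec.skip s, le_rfl, h⟩
  | assign x e => exact ⟨_, _, Exec.assign s x e, le_rfl, h⟩
  | store a i e => exact ⟨_, _, Exec.store s a i e, le_rfl, h⟩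
  | seq p q ihp ihq => exact (ihp h).seq fun s' h' => ihq h'
  | ifLt e₁ e₂ p q ihp ihq =>
    exact Runs.ifLt (fun hlt => (ihp (h.1 hlt)).mono (le_max_left _ _) fun _ => id)
      fun hlt => (ihq (h.2 hlt)).mono (le_max_right _ _) fun _ => id
  | whileLt => exact h.elim

@[simp] theorem State.setReg_reg (s : State) (x v : ℕ) :
    (s.setReg x v).reg = Function.update s.reg x v := rfl

@[simp] theorem State.setReg_arr (s : State) (x v : ℕ) : (s.setReg x v).arr = s.arr := rfl

@[simp] theorem State.setArr_reg (s : State) (a i v : ℕ) : (s.setArr a i v).reg = s.reg := rfl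

@[simp] theorem State.setArr_arr (s : State) (a i v : ℕ) :
    (s.setArr a i v).arr = Function.update s.arr a (Function.update (s.arr a) i v) := rfl

/-! ### The program

Registers: `0` answer, `1` number of workers, `2` number of firms, `3` number of slots, `4`, `5`
firm and rank of a slot, `6`, `8` addresses in the input, `7` worker counter, `9` entered bidders,
`10` bidding bidder, `11` slot counter, `12`, `13` lowest price found and its slot, `14` evicted
bidder. Arrays: `0` input, `1`, `2` firm and rank of a slot, `3` address of the values of the firm
of a slot, `4` address of the values of a worker, `5` owners, `6` prices. -/

open RAM.Prog RAM.Expr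

/-- Tabulate the addresses of the workers' values. -/
def tabulateWorkers : Prog :=
  whileLt (reg 7) (reg 1)
    (seq (assign 7 (add (reg 7) (lit 1)))
      (seq (assign 8 (add (reg 8) (reg 2))) (store 4 (reg 7) (reg 8))))

/-- Tabulate the firms and ranks of the slots and the addresses of the values of their firms. -/
def tabulateSlots : Prog :=
  whileLt (reg 4) (reg 2)
    (seq (store 1 (reg 3) (reg 4)) (seq (store 2 (reg 3) (reg 5)) (seq (store 3 (reg 3) (reg 6))
      (seq (assign 3 (add (reg 3) (lit 1)))
        (ifLt (reg 5) (reg 1) (assign 5 (add (reg 5) (lit 1)))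
          (seq (assign 5 (lit 0)) (seq (assign 4 (add (reg 4) (lit 1)))
            (assign 6 (add (reg 6) (reg 1))))))))))

/-- Remember the slot in register `11` if it is cheaper than those seen before. -/
def keepCheaper : Prog :=
  ifLt (read 6 (reg 11)) (reg 12)
    (seq (assign 12 (read 6 (reg 11))) (assign 13 (reg 11))) skip

/-- Run `p` if the bidder in register `10` accepts the slot in register `11`. -/
def ifAccepts (p : Prog) : Prog :=
  ifLt (reg 1) (reg 10)
    (ifLt (lit 0) (read 2 (reg 11)) p skip)
    (ifLt (read 2 (reg 11)) (read 0 (add (lit 2) (read 1 (reg 11))))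
      (ifLt (lit 0) (read 0 (add (read 4 (reg 10)) (read 1 (reg 11))))
        (ifLt (lit 0) (add (read 2 (reg 11)) (read 0 (add (read 3 (reg 11)) (reg 10)))) p skip)
        skip) skip)

/-- Find the cheapest slot that the bidder in register `10` accepts. -/
def findCheapest : Prog :=
  seq (seq (assign 11 (lit 0)) (assign 12 (add (reg 3) (lit 2))))
    (whileLt (reg 11) (reg 3)
      (seq (ifAccepts keepCheaper) (assign 11 (add (reg 11) (lit 1)))))

/-- Give the cheapest slot to the bidding bidder, or reject if it is too expensive. -/
def placeBid : Prog :=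
  ifLt (reg 12) (add (reg 3) (lit 2))
    (seq (assign 14 (read 5 (reg 13))) (seq (store 5 (reg 13) (reg 10))
      (seq (store 6 (reg 13) (add (read 6 (reg 13)) (lit 1))) (assign 10 (reg 14)))))
    (seq (assign 0 (lit 0)) (seq (assign 10 (lit 0)) (assign 9 (reg 3))))

/-- The auction. -/
def auction : Prog :=
  whileLt (reg 9) (add (reg 3) (reg 10))
    (ifLt (lit 0) (reg 10) (seq findCheapest placeBid)
      (seq (assign 9 (add (reg 9) (lit 1))) (assign 10 (reg 9))))

/-- Decide whether some matching has nonzero Nash welfare. -/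
def nashProg : Prog :=
  seq (seq (assign 1 (read 0 (lit 0))) (assign 2 (read 0 (lit 1))))
    (ifLt (lit 0) (reg 2)
      (seq (assign 8 (lit 2)) (seq tabulateWorkers
        (seq (assign 6 (sub (add (reg 8) (reg 2)) (lit 1))) (seq tabulateSlots
          (seq (assign 0 (lit 1)) auction)))))
      (ifLt (lit 0) (reg 1) skip (assign 0 (lit 1))))

/-! ### Its correctness -/

/-- Without multiplication, the addresses `2 + c * n` are accumulated by repeated addition in
register 8. -/
theorem tabulateWorkers_runs {s : State} (a : ℕ → ℕ) (m n : ℕ) (h0 : s.arr 0 = a)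
    (h1 : s.reg 1 = m) (h2 : s.reg 2 = n) (h7 : s.reg 7 = 0) (h8 : s.reg 8 = 2)
    (hz : ∀ x, x ≠ 1 → x ≠ 2 → x ≠ 8 → s.reg x = 0) (hA : s.arr 5 = fun _ => 0)
    (hA6 : s.arr 6 = fun _ => 0) :
    Runs tabulateWorkers s ((m + 1) * 14) fun s' => s'.arr 0 = a ∧ s'.reg 1 = m ∧ s'.reg 2 = n ∧
      s'.reg 8 = 2 + m * n ∧ (∀ x, x ≠ 1 → x ≠ 2 → x ≠ 7 → x ≠ 8 → s'.reg x = 0) ∧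
      (s'.arr 5 = fun _ => 0) ∧ (s'.arr 6 = fun _ => 0) ∧
      ∀ c, 1 ≤ c → c ≤ m → s'.arr 4 c = 2 + c * n := by
  refine (Runs.whileLt (fun s' => s'.arr 0 = a ∧ s'.reg 1 = m ∧ s'.reg 2 = n ∧
      s'.reg 7 ≤ m ∧ s'.reg 8 = 2 + s'.reg 7 * n ∧
      (∀ x, x ≠ 1 → x ≠ 2 → x ≠ 7 → x ≠ 8 → s'.reg x = 0) ∧
      (s'.arr 5 = fun _ => 0) ∧ (s'.arr 6 = fun _ => 0) ∧
      ∀ c, 1 ≤ c → c ≤ s'.reg 7 → s'.arr 4 c = 2 + c * n) (fun s' => m - s'.reg 7) 11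
      ?_ ?_).mono ?_ ?_
  · rintro s ⟨h0, h1, h2, h7, h8, hz, h5, h6, h4⟩ hlt
    simp only [eval, h1] at hlt
    refine Runs.mono (Prog.wp.runs ?_) (le_of_eq rfl) fun _ => id
    simp only [wp, eval, State.setReg_reg, State.setReg_arr, State.setArr_reg, State.setArr_arr]
    simp [h0, h1, h2, h5, h6, h8]
    refine ⟨⟨by omega, by ring, ?_, ?_⟩, by omega⟩
    · intro x x1 x2 x7 x8
      simpa [x7, x8] using hz x x1 x2 x7 x8
    · intro c hc1 hc2
      rcases eq_or_ne c (s.reg 7 + 1) with rfl | hne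
      · simp; ring
      · simpa [hne] using h4 c hc1 (by omega)
  · refine ⟨h0, h1, h2, by omega, by simp [h7, h8], fun x x1 x2 x7 x8 => hz x x1 x2 x8, hA, hA6,
      fun c hc1 hc2 => by omega⟩
  · simp [h7, cost]
  · rintro s' ⟨⟨h0, h1, h2, h7, h8, hz, h5, h6, h4⟩, hlt⟩
    simp only [eval, h1] at hlt
    have h7' : s'.reg 7 = m := by omega
    rw [h7'] at h8 h4
    exact ⟨h0, h1, h2, h8, hz, h5, h6, h4⟩

/-- Division by `m + 1` is replaced by two counters: registers 4 and 5 hold quotient and remainder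
of the slot number in register 3. On exit the remainder has just wrapped to 0. -/
theorem tabulateSlots_runs {s : State} (a : ℕ → ℕ) (m n : ℕ) (h0 : s.arr 0 = a)
    (h1 : s.reg 1 = m) (h2 : s.reg 2 = n) (h6 : s.reg 6 = 1 + n + m * n)
    (hz : ∀ x, x ≠ 1 → x ≠ 2 → x ≠ 6 → x ≠ 7 → x ≠ 8 → s.reg x = 0) (hA : s.arr 5 = fun _ => 0)
    (hA6 : s.arr 6 = fun _ => 0) (hA4 : ∀ c, 1 ≤ c → c ≤ m → s.arr 4 c = 2 + c * n) :
    Runs tabulateSlots s ((n * (m + 1) + 1) * 29) fun s' => s'.arr 0 = a ∧ s'.reg 1 = m ∧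
      s'.reg 3 = n * (m + 1) ∧ s'.reg 9 = 0 ∧ s'.reg 10 = 0 ∧
      (s'.arr 5 = fun _ => 0) ∧ (s'.arr 6 = fun _ => 0) ∧
      (∀ c, 1 ≤ c → c ≤ m → s'.arr 4 c = 2 + c * n) ∧
      ∀ t < n * (m + 1), s'.arr 1 t = t / (m + 1) ∧ s'.arr 2 t = t % (m + 1) ∧
        s'.arr 3 t = 1 + n + m * n + t / (m + 1) * m := by
  refine (Runs.whileLt (fun s' => s'.arr 0 = a ∧ s'.reg 1 = m ∧ s'.reg 2 = n ∧
      s'.reg 9 = 0 ∧ s'.reg 10 = 0 ∧ (s'.arr 5 = fun _ => 0) ∧ (s'.arr 6 = fun _ => 0) ∧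
      (∀ c, 1 ≤ c → c ≤ m → s'.arr 4 c = 2 + c * n) ∧
      s'.reg 5 < m + 1 ∧ s'.reg 3 = s'.reg 4 * (m + 1) + s'.reg 5 ∧
      (s'.reg 4 < n ∨ s'.reg 4 = n ∧ s'.reg 5 = 0) ∧
      s'.reg 6 = 1 + n + m * n + s'.reg 4 * m ∧
      ∀ t < s'.reg 3, s'.arr 1 t = t / (m + 1) ∧ s'.arr 2 t = t % (m + 1) ∧
        s'.arr 3 t = 1 + n + m * n + t / (m + 1) * m) (fun s' => n * (m + 1) - s'.reg 3) 26
      ?_ ?_).mono ?_ ?_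
  · rintro s ⟨h0, h1, h2, h9, h10, hA, hA6, hA4, h5, h3, h4, h6, hT⟩ hlt
    simp only [eval, h2] at hlt
    refine Runs.mono (Prog.wp.runs ?_) (le_of_eq rfl) fun _ => id
    have hdiv := MatchingInstance.slot_div (s.reg 4) h5
    have hmod := MatchingInstance.slot_mod (s.reg 4) h5
    have hslot := MatchingInstance.slot_lt hlt h5
    rw [← h3] at hdiv hmod hslot
    have hT' : ∀ t ≤ s.reg 3,
        Function.update (s.arr 1) (s.reg 3) (s.reg 4) t = t / (m + 1) ∧
        Function.update (s.arr 2) (s.reg 3) (s.reg 5) t = t % (m + 1) ∧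
        Function.update (s.arr 3) (s.reg 3) (s.reg 6) t
          = 1 + n + m * n + t / (m + 1) * m := by
      intro t ht
      rcases eq_or_ne t (s.reg 3) with rfl | hne
      · simp [hdiv, hmod, h6]
      · simpa [hne] using hT t (by omega)
    simp only [wp, eval, State.setReg_reg, State.setReg_arr, State.setArr_reg, State.setArr_arr]
    simp [h0, h1, h2, h9, h10, hA, hA6, h6]
    rw [h6] at hT'
    refine ⟨fun hlt5 => ⟨⟨hA4, by omega, by omega, by omega, hT'⟩, by omega⟩,
      fun hle => ⟨⟨hA4, ?_, by omega, by ring, hT'⟩, by omega⟩⟩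
    have : s.reg 5 = m := by omega
    rw [h3, this]
    ring
  · refine ⟨h0, h1, h2, hz 9 ?_ ?_ ?_ ?_ ?_, hz 10 ?_ ?_ ?_ ?_ ?_, hA, hA6, hA4, ?_⟩
    iterate 10 simp
    have h3 : s.reg 3 = 0 := hz 3 (by simp) (by simp) (by simp) (by simp) (by simp)
    have h4 : s.reg 4 = 0 := hz 4 (by simp) (by simp) (by simp) (by simp) (by simp)
    have h5 : s.reg 5 = 0 := hz 5 (by simp) (by simp) (by simp) (by simp) (by simp)
    simp [h3, h4, h5, h6]
    omega
  · have h3 : s.reg 3 = 0 := hz 3 (by simp) (by simp) (by simp) (by simp) (by simp)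
    simp [h3, cost]
  · rintro s' ⟨⟨h0, h1, h2, h9, h10, hA, hA6, hA4, h5, h3, h4, h6, hT⟩, hlt⟩
    simp only [eval, h2] at hlt
    have h4' : s'.reg 4 = n ∧ s'.reg 5 = 0 := by omega
    rw [h4'.1, h4'.2, Nat.add_zero] at h3
    rw [h3] at hT
    exact ⟨h0, h1, h3, h9, h10, hA, hA6, hA4, hT⟩

/-! ### The bidding loop and its potential. -/

/-- The tables which the auction consults describe the acceptability relation `SlotAdj a m n`. -/
structure Tables (a : ℕ → ℕ) (m n : ℕ) (s : State) : Prop where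
  input : s.arr 0 = a
  workers : s.reg 1 = m
  slots : s.reg 3 = n * (m + 1)
  workerAddr : ∀ c, 1 ≤ c → c ≤ m → s.arr 4 c = 2 + c * n
  slotAddr : ∀ t < n * (m + 1), s.arr 1 t = t / (m + 1) ∧ s.arr 2 t = t % (m + 1) ∧
    s.arr 3 t = 1 + n + m * n + t / (m + 1) * m

theorem Tables.congr {a : ℕ → ℕ} {m n : ℕ} {s s' : State} (h : Tables a m n s)
    (h0 : s'.arr 0 = s.arr 0) (h1 : s'.reg 1 = s.reg 1) (h3 : s'.reg 3 = s.reg 3)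
    (ha1 : s'.arr 1 = s.arr 1) (ha2 : s'.arr 2 = s.arr 2) (ha3 : s'.arr 3 = s.arr 3)
    (ha4 : s'.arr 4 = s.arr 4) : Tables a m n s' := by
  obtain ⟨h4, h5, h6, h7, h8⟩ := h
  constructor
  · rw [h0, h4]
  · rw [h1, h5]
  · rw [h3, h6]
  · rwa [ha4]
  · rwa [ha1, ha2, ha3]

theorem wp_ifAccepts {a : ℕ → ℕ} {m n : ℕ} {s : State} (h : Tables a m n s) (h10 : s.reg 10 ≠ 0)
    (h11 : s.reg 11 < n * (m + 1)) {p : Prog} {Q : State → Prop}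
    (hp : SlotAdj a m n (s.reg 10) (s.reg 11) → p.wp Q s)
    (hskip : ¬ SlotAdj a m n (s.reg 10) (s.reg 11) → Q s) : (ifAccepts p).wp Q s := by
  obtain ⟨ha, h1, h3, hw, hslot⟩ := h
  obtain ⟨t1, t2, t3⟩ := hslot _ h11
  simp only [ifAccepts, wp, eval, ha, h1, t1, t2, t3]
  rw [SlotAdj] at hp hskip
  by_cases hm : s.reg 10 ≤ m
  · rw [if_pos hm] at hp hskip
    rw [hw _ (Nat.pos_of_ne_zero h10) hm]
    exact ⟨fun hlt => absurd hm (by omega), fun _ => ⟨fun b1 => ⟨fun b2 =>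
      ⟨fun b3 => hp ⟨b1, b2, b3⟩, fun b3 => hskip fun b => b3 b.2.2⟩,
      fun b2 => hskip fun b => b2 b.2.1⟩, fun b1 => hskip fun b => b1 b.1⟩⟩
  · rw [if_neg hm] at hp hskip
    exact ⟨fun _ => ⟨hp, hskip⟩, fun hlt => absurd hm (by omega)⟩

/-- The search starts from the price N + 2, which is also the rejection level, so having no
acceptable slot and having only slots at that level are treated alike. -/
theorem findCheapest_runs {a : ℕ → ℕ} {m n : ℕ} {s : State} (h : Tables a m n s)
    (h10 : s.reg 10 ≠ 0) :
    Runs findCheapest s (6 + (n * (m + 1) + 1) * 50) fun s' => Tables a m n s' ∧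
      s'.reg 0 = s.reg 0 ∧ s'.reg 9 = s.reg 9 ∧ s'.reg 10 = s.reg 10 ∧ s'.arr 5 = s.arr 5 ∧
      s'.arr 6 = s.arr 6 ∧
      (∀ t < n * (m + 1), SlotAdj a m n (s.reg 10) t → s'.reg 12 ≤ s.arr 6 t) ∧
      (s'.reg 12 < n * (m + 1) + 2 → s'.reg 13 < n * (m + 1) ∧
        SlotAdj a m n (s.reg 10) (s'.reg 13) ∧ s.arr 6 (s'.reg 13) = s'.reg 12) ∧
      s'.reg 12 ≤ n * (m + 1) + 2 := by
  refine Runs.seq (T := 6) (T' := (n * (m + 1) + 1) * 50)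
    (Q := fun s' => Tables a m n s' ∧ s'.reg 0 = s.reg 0 ∧ s'.reg 9 = s.reg 9 ∧
      s'.reg 10 = s.reg 10 ∧ s'.arr 5 = s.arr 5 ∧ s'.arr 6 = s.arr 6 ∧ s'.reg 11 = 0 ∧
      s'.reg 12 = n * (m + 1) + 2) ?_ ?_
  · refine Runs.mono (Prog.wp.runs ?_) (le_of_eq rfl) fun _ => id
    simp only [wp, eval, State.setReg_reg, State.setReg_arr]
    simp [h.slots]
    exact h.congr (by simp) (by simp) (by simp) (by simp) (by simp) (by simp) (by simp)
  · rintro s₁ ⟨hT, h0, h9, h10', h5, h6, h11, h12⟩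
    refine (Runs.whileLt (fun s' => Tables a m n s' ∧ s'.reg 0 = s.reg 0 ∧
      s'.reg 9 = s.reg 9 ∧ s'.reg 10 = s.reg 10 ∧ s'.arr 5 = s.arr 5 ∧ s'.arr 6 = s.arr 6 ∧
      s'.reg 11 ≤ n * (m + 1) ∧
      (∀ t < s'.reg 11, SlotAdj a m n (s.reg 10) t → s'.reg 12 ≤ s.arr 6 t) ∧
      (s'.reg 12 < n * (m + 1) + 2 → s'.reg 13 < n * (m + 1) ∧
        SlotAdj a m n (s.reg 10) (s'.reg 13) ∧ s.arr 6 (s'.reg 13) = s'.reg 12) ∧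
      s'.reg 12 ≤ n * (m + 1) + 2) (fun s' => n * (m + 1) - s'.reg 11) 47 ?_ ?_).mono ?_ ?_
    · rintro s' ⟨hT, h0, h9, h10', h5, h6, h11, hmin, hbest, h12⟩ hlt
      simp only [eval, hT.slots] at hlt
      refine Runs.mono (Prog.wp.runs ?_) (show _ ≤ 47 by decide) fun _ => id
      rw [wp]
      refine wp_ifAccepts hT (by rwa [h10']) hlt (fun hadj => ?_) fun hadj => ?_
      · simp only [keepCheaper, wp, eval, State.setReg_reg, State.setReg_arr]
        rw [h10'] at hadj
        simp [h0, h9, h10', h5, h6]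
        refine ⟨fun hch => ⟨⟨?_, by omega, ?_, fun _ => ⟨by omega, hadj⟩, by omega⟩, by omega⟩,
          fun hch => ⟨⟨?_, by omega, ?_, hbest, by omega⟩, by omega⟩⟩
        · exact hT.congr (by simp) (by simp) (by simp) (by simp) (by simp) (by simp) (by simp)
        · intro t ht hat
          rcases Nat.lt_or_ge t (s'.reg 11) with h | h
          · have := hmin t h hat
            omega
          · rw [show t = s'.reg 11 by omega]
        · exact hT.congr (by simp) (by simp) (by simp) (by simp) (by simp) (by simp) (by simp)
        · intro t ht hat
          rcases Nat.lt_or_ge t (s'.reg 11) with h | h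
          · exact hmin t h hat
          · rw [show t = s'.reg 11 by omega]
            exact hch
      · simp only [wp, eval, State.setReg_reg, State.setReg_arr]
        rw [h10'] at hadj
        simp [h0, h9, h10', h5, h6]
        refine ⟨⟨?_, by omega, ?_, hbest, by omega⟩, by omega⟩
        · exact hT.congr (by simp) (by simp) (by simp) (by simp) (by simp) (by simp) (by simp)
        · intro t ht hat
          rcases Nat.lt_or_ge t (s'.reg 11) with h | h
          · exact hmin t h hat
          · rw [show t = s'.reg 11 by omega] at hat
            exact absurd hat hadj
    · refine ⟨hT, h0, h9, h10', h5, h6, by omega, fun t ht => by omega, fun hlt => by omega,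
        h12.le⟩
    · simp [h11, cost]
    · rintro s' ⟨⟨hT, h0, h9, h10', h5, h6, h11, hmin, hbest, h12⟩, hlt⟩
      simp only [eval, hT.slots] at hlt
      rw [show s'.reg 11 = n * (m + 1) by omega] at hmin
      exact ⟨hT, h0, h9, h10', h5, h6, hmin, hbest, h12⟩

/-- The invariant of the main loop: the auction is going on, or it has been ended by a rejection. -/
def AuctionInv (a : ℕ → ℕ) (m n : ℕ) (s : State) : Prop :=
  Tables a m n s ∧
    (s.reg 0 = 1 ∧
        Auction.Inv (n * (m + 1)) (SlotAdj a m n) (s.arr 5) (s.arr 6) (s.reg 9) (s.reg 10) ∨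
      s.reg 0 = 0 ∧ s.reg 9 = n * (m + 1) ∧ s.reg 10 = 0 ∧
        ¬ Auction.HasPerfectMatching (n * (m + 1)) (SlotAdj a m n))

/-- A bound for the number of further rounds of the auction. -/
def roundsLeft (N : ℕ) (s : State) : ℕ :=
  2 * (N * (N + 2) - ∑ t ∈ Finset.range N, s.arr 6 t) + 2 * (N - s.reg 9)
    + if s.reg 10 = 0 then 0 else 1

theorem sum_update_succ {N b : ℕ} (hb : b < N) (p : ℕ → ℕ) :
    ∑ t ∈ Finset.range N, Function.update p b (p b + 1) t
      = (∑ t ∈ Finset.range N, p t) + 1 := by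
  rw [Finset.sum_update_of_mem (Finset.mem_range.2 hb),
    Finset.sum_eq_add_sum_sdiff_singleton_of_mem (Finset.mem_range.2 hb) p]
  ring

/-- A bid raises the price sum by one and an entry raises register 9 by one; either lowers the
potential by 2, which outweighs the 1 that a waiting bidder may add. A rejection clears the waiting
bidder and so loses that 1. -/
theorem auction_body_runs {a : ℕ → ℕ} {m n : ℕ} {s : State} (h : AuctionInv a m n s)
    (hlt : s.reg 9 < n * (m + 1) + s.reg 10) :
    Runs (ifLt (lit 0) (reg 10) (seq findCheapest placeBid)
      (seq (assign 9 (add (reg 9) (lit 1))) (assign 10 (reg 9)))) s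
      (3 + (6 + (n * (m + 1) + 1) * 50 + 22)) fun s' => AuctionInv a m n s' ∧
        roundsLeft (n * (m + 1)) s' < roundsLeft (n * (m + 1)) s := by
  obtain ⟨hT, hA | ⟨-, h9, h10, -⟩⟩ := h
  swap
  · omega
  obtain ⟨h0, hA⟩ := hA
  refine Runs.ifLt (fun hpos => ?_) fun hpos => ?_
  · simp only [eval] at hpos
    refine (findCheapest_runs hT hpos.ne').seq (T' := 22) ?_
    rintro s' ⟨hT', h0', h9', h10', h5', h6', hmin, hbest, h12⟩
    refine Runs.mono (Prog.wp.runs ?_) (show _ ≤ 22 by decide) fun _ => id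
    simp only [placeBid, wp, eval, State.setReg_reg, State.setReg_arr, State.setArr_reg,
      State.setArr_arr, hT'.slots]
    refine ⟨fun hch => ?_, fun hch => ?_⟩
    · obtain ⟨hb, hadj, hprice⟩ := hbest hch
      have hA' := hA.bid hpos.ne' hb hadj (by rw [hprice]; exact hmin) (by rwa [hprice])
      constructor
      · refine ⟨hT'.congr (by simp) (by simp) (by simp) (by simp) (by simp) (by simp) (by simp),
          Or.inl ?_⟩
        simp only [State.setReg_reg, State.setReg_arr, State.setArr_reg, State.setArr_arr]
        simpa [h0', h0, h5', h6', h9', h10'] using hA'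
      · have hsum := sum_update_succ hb (s.arr 6)
        have hle : ∑ t ∈ Finset.range (n * (m + 1)),
            Function.update (s.arr 6) (s'.reg 13) (s.arr 6 (s'.reg 13) + 1) t
              ≤ n * (m + 1) * (n * (m + 1) + 2) := by
          refine (Finset.sum_le_card_nsmul _ _ (n * (m + 1) + 2) fun t ht =>
            hA'.price_le t (Finset.mem_range.1 ht)).trans (by simp)
        unfold roundsLeft
        simp only [State.setReg_reg, State.setReg_arr, State.setArr_reg, State.setArr_arr]
        simp [h5', h6', h9', hpos.ne']
        rw [hsum] at hle ⊢
        split_ifs <;> omega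
    · constructor
      · refine ⟨hT'.congr (by simp) (by simp) (by simp [hT'.slots]) (by simp) (by simp) (by simp)
          (by simp), Or.inr ?_⟩
        simp only [State.setReg_reg]
        simp [hT'.slots]
        exact hA.not_hasPerfectMatching hpos.ne' fun t ht hadj => by
          have := hmin t ht hadj
          omega
      · unfold roundsLeft
        simp only [State.setReg_reg]
        simp [h6', hpos.ne', hT'.slots]
  · simp only [eval] at hpos
    have h10 : s.reg 10 = 0 := by omega
    rw [h10] at hA
    refine Runs.mono (Prog.wp.runs ?_) (show _ ≤ 6 + (n * (m + 1) + 1) * 50 + 22 from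
      le_trans (show _ ≤ 22 by decide) (Nat.le_add_left _ _)) fun _ => id
    simp only [wp, eval, State.setReg_reg]
    constructor
    · refine ⟨hT.congr (by simp) (by simp) (by simp) (by simp) (by simp) (by simp) (by simp),
        Or.inl ?_⟩
      simp only [State.setReg_reg, State.setReg_arr]
      simpa [h0] using hA.enter (by omega)
    · unfold roundsLeft
      simp only [State.setReg_reg, State.setReg_arr]
      simp [h10]
      omega

theorem auction_runs {a : ℕ → ℕ} {m n : ℕ} {s : State} (hT : Tables a m n s) (h0 : s.reg 0 = 1)
    (h5 : s.arr 5 = fun _ => 0) (h6 : s.arr 6 = fun _ => 0) (h9 : s.reg 9 = 0)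
    (h10 : s.reg 10 = 0) :
    Runs auction s ((2 * (n * (m + 1) * (n * (m + 1) + 2)) + 2 * (n * (m + 1)) + 1) *
        (5 + (3 + (6 + (n * (m + 1) + 1) * 50 + 22)))) fun s' =>
      (Auction.HasPerfectMatching (n * (m + 1)) (SlotAdj a m n) → s'.reg 0 = 1) ∧
      (¬ Auction.HasPerfectMatching (n * (m + 1)) (SlotAdj a m n) → s'.reg 0 = 0) := by
  refine (Runs.whileLt (AuctionInv a m n) (roundsLeft (n * (m + 1)))
    (3 + (6 + (n * (m + 1) + 1) * 50 + 22)) ?_ ?_).mono ?_ ?_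
  · intro s hs hlt
    simp only [eval, hs.1.slots] at hlt
    exact auction_body_runs hs hlt
  · refine ⟨hT, Or.inl ⟨h0, ?_⟩⟩
    rw [h5, h6, h9, h10]
    exact Auction.Inv.start _ _
  · simp [roundsLeft, h6, h9, h10, cost]
  · rintro s' ⟨⟨hT', h | h⟩, hlt⟩
    -- As register 9 is at most N, failure of the test means that all bidders have entered and none
    -- is waiting.
    · simp only [eval, hT'.slots] at hlt
      obtain ⟨h0', hA⟩ := h
      have h1 := hA.entered_le
      have h2 : s'.reg 9 = n * (m + 1) := by omega
      have h3 : s'.reg 10 = 0 := by omega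
      rw [h2, h3] at hA
      exact ⟨fun _ => h0', fun hno => absurd hA.hasPerfectMatching hno⟩
    · exact ⟨fun hyes => absurd hyes h.2.2.2, fun _ => h.1⟩

/-! ### The whole program and its polynomial bound. -/

theorem nashProg_runs (I : MatchingInstance) (L : ℕ) (hL : I.encode.length ≤ L) :
    Runs nashProg (State.init I.encode)
      (6 + (3 + (2 + ((L + 1) * 14 + (6 + ((L + 1) * 29 + (2 +
        (2 * (L * (L + 2)) + 2 * L + 1) * (5 + (3 + (6 + (L + 1) * 50 + 22)))))))))) fun s' =>
      (I.HasNonzeroNash → s'.reg 0 = 1) ∧ (¬ I.HasNonzeroNash → s'.reg 0 = 0) := by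
  rw [I.length_encode] at hL
  set a : ℕ → ℕ := fun i => I.encode.getD i 0 with ha
  have ha0 : a 0 = I.m := rfl
  have ha1 : a 1 = I.n := rfl
  refine Runs.seq (Q := fun s => s.arr 0 = a ∧ s.reg 1 = I.m ∧ s.reg 2 = I.n ∧
    (∀ x, x ≠ 1 → x ≠ 2 → s.reg x = 0) ∧ (s.arr 5 = fun _ => 0) ∧ (s.arr 6 = fun _ => 0)) ?_ ?_
  · refine Runs.mono (Prog.wp.runs ?_) (le_of_eq rfl) fun _ => id
    simp only [wp, eval, State.setReg_reg, State.setReg_arr]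
    simp [State.init, MatchingInstance.encode, ha]
    intro x x1 x2
    simp [x1, x2]
  rintro s ⟨h0, h1, h2, hz, h5, h6⟩
  refine Runs.ifLt (fun hn => ?_) fun hn => ?_
  · simp only [eval, h2] at hn
    -- Here a firm is needed: for `n = 0` the list has two entries however large `m` is, so a loop
    -- over the workers could take exponential time. The program treats that case separately.
    have hmn : I.m ≤ I.m * I.n := Nat.le_mul_of_pos_right _ hn
    have hN : I.n * (I.m + 1) ≤ L := by rw [Nat.mul_add, Nat.mul_comm]; omega
    have hm : I.m ≤ L := by omega
    have hequiv : I.HasNonzeroNash ↔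
        Auction.HasPerfectMatching (I.n * (I.m + 1)) (SlotAdj a I.m I.n) :=
      ⟨I.hasPerfectMatching_of_hasNonzeroNash, fun h => I.hasNonzeroNash_of_hasPerfectMatching h hn⟩
    rw [hequiv]
    refine Runs.seq (Q := fun s => s.arr 0 = a ∧ s.reg 1 = I.m ∧ s.reg 2 = I.n ∧ s.reg 7 = 0 ∧
      s.reg 8 = 2 ∧ (∀ x, x ≠ 1 → x ≠ 2 → x ≠ 8 → s.reg x = 0) ∧
      (s.arr 5 = fun _ => 0) ∧ (s.arr 6 = fun _ => 0)) ?_ ?_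
    · refine Runs.mono (Prog.wp.runs ?_) (le_of_eq rfl) fun _ => id
      simp only [wp, eval, State.setReg_reg, State.setReg_arr]
      simp [h0, h1, h2, h5, h6, hz 7]
      intro x x1 x2 x8
      simpa [x8] using hz x x1 x2
    rintro s ⟨h0, h1, h2, h7, h8, hz, h5, h6⟩
    refine Runs.seq ((tabulateWorkers_runs a I.m I.n h0 h1 h2 h7 h8 hz h5 h6).mono
      (by gcongr) fun _ => id) ?_
    rintro s ⟨h0, h1, h2, h8, hz, h5, h6, h4⟩
    refine Runs.seq (Q := fun s => s.arr 0 = a ∧ s.reg 1 = I.m ∧ s.reg 2 = I.n ∧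
      s.reg 6 = 1 + I.n + I.m * I.n ∧
      (∀ x, x ≠ 1 → x ≠ 2 → x ≠ 6 → x ≠ 7 → x ≠ 8 → s.reg x = 0) ∧
      (s.arr 5 = fun _ => 0) ∧ (s.arr 6 = fun _ => 0) ∧
      ∀ c, 1 ≤ c → c ≤ I.m → s.arr 4 c = 2 + c * I.n) ?_ ?_
    · refine Runs.mono (Prog.wp.runs ?_) (le_of_eq rfl) fun _ => id
      simp only [wp, eval, State.setReg_reg, State.setReg_arr]
      simp [h0, h1, h2, h5, h6, h8]
      refine ⟨by omega, ?_, h4⟩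
      intro x x1 x2 x6 x7 x8
      simpa [x6] using hz x x1 x2 x7 x8
    rintro s ⟨h0, h1, h2, h6r, hz, h5, h6, h4⟩
    refine Runs.seq (Q := fun s => s.reg 9 = 0 ∧ s.reg 10 = 0 ∧ (s.arr 5 = fun _ => 0) ∧
        (s.arr 6 = fun _ => 0) ∧ Tables a I.m I.n s)
      ((tabulateSlots_runs a I.m I.n h0 h1 h2 h6r hz h5 h6 h4).mono (by gcongr) ?_) ?_
    · rintro s ⟨h0, h1, h3, h9, h10, h5, h6, h4, hT⟩
      exact ⟨h9, h10, h5, h6, h0, h1, h3, h4, hT⟩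
    rintro s ⟨h9, h10, h5, h6, hT⟩
    refine Runs.seq (Q := fun s => s.reg 0 = 1 ∧ s.reg 9 = 0 ∧ s.reg 10 = 0 ∧
      (s.arr 5 = fun _ => 0) ∧ (s.arr 6 = fun _ => 0) ∧ Tables a I.m I.n s) ?_ ?_
    · refine Runs.mono (Prog.wp.runs ?_) (le_of_eq rfl) fun _ => id
      simp only [wp, eval]
      refine ⟨by simp, by simpa using h9, by simpa using h10, h5, h6,
        hT.congr (by simp) (by simp) (by simp) (by simp) (by simp) (by simp) (by simp)⟩
    rintro s ⟨h0, h9, h10, h5, h6, hT⟩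
    refine (auction_runs hT h0 h5 h6 h9 h10).mono ?_ fun _ => id
    gcongr
  · simp only [eval, h2] at hn
    have hn0 : I.n = 0 := by omega
    refine Runs.mono (Prog.wp.runs ?_) (show _ ≤ _ from
      le_trans (show _ ≤ 14 by decide) (by omega)) fun _ => id
    simp only [wp, eval, h1]
    have : IsEmpty (Fin I.n) := by rw [hn0]; infer_instance
    -- Without firms no worker can be assigned, so the answer is the initial 0 of register 0;
    -- without any agents the condition is vacuous.
    refine ⟨fun hm => ⟨fun h => ?_, fun _ => hz 0 (by simp) (by simp)⟩, fun hm =>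
      ⟨fun _ => by simp, fun h => absurd ?_ h⟩⟩
    · obtain ⟨g, -⟩ := I.hasNonzeroNash_iff.1 h
      exact isEmptyElim (g ⟨0, hm⟩)
    · have : IsEmpty (Fin I.m) := by rw [show I.m = 0 by omega]; infer_instance
      exact I.hasNonzeroNash_iff.2 ⟨isEmptyElim, isEmptyElim, isEmptyElim, isEmptyElim⟩

end RAM

theorem mainTheorem12 :
    RAM.PolyTimeDecidable MatchingInstance.encode MatchingInstance.HasNonzeroNash := by
  open Polynomial in
  refine ⟨RAM.nashProg, 6 + (3 + (2 + ((X + 1) * 14 + (6 + ((X + 1) * 29 + (2 +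
    (2 * (X * (X + 2)) + 2 * X + 1) * (5 + (3 + (6 + (X + 1) * 50 + 22))))))))), fun I => ?_⟩
  obtain ⟨t, s', he, ht, hQ⟩ :=
    RAM.nashProg_runs I (RAM.bitLength I.encode) (RAM.length_le_bitLength _)
  refine ⟨t, s', he, ht.trans (le_of_eq ?_), hQ⟩
  simp
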